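/- Trees are finite non-planar rooted trees (open edges allowed). The symmetric coloured operad $\Omega(T)$ freely generated by the vertices of a tree $T$ has the edges of $T$ as colours. The category $\Omega$ has trees as objects and the maps of operads $\Omega(R)\to\Omega(T)$ as morphisms $R\to T$; a dendroidal set is a functor $\Omega^{op}\to \mathrm{Sets}$. For $k\in\mathbb N$ let $i_k:\Omega_k\to\Omega$ be the inclusion of the full subcategory of trees with at most $k$ vertices; a dendroidal set $Y$ is $k$-coskeletal if the canonical map $Y\to (i_k)_*i_k^*Y$ is an isomorphism, where $(i_k)_*$ is the right adjoint (right Kan extension) of the restriction functor $i_k^*$. Let $\mathbb S$ be a category with finite products, regarded as an operad with operations $\mathbb S(s_1,\dots,s_n;s)=\mathrm{Hom}(s_1\times\dots\times s_n,s)$, and let $N_d(\mathbb S)_T=\mathrm{Op}(\Omega(T),\mathbb S)$ be its dendroidal nerve. For $t\in N_d(\mathbb S)_T$ put $\mathrm{in}(t)=\prod_{l} t(l)$, the product over the leaves $l$ of $T$ (the edges that are not the outgoing edge of a vertex). For a map $\alpha:R\to T$ in $\Omega$ let $\mathrm{in}(\alpha):\mathrm{in}(t)\to\mathrm{in}(\alpha^*t)$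 be the morphism whose component at a leaf $m$ of $R$ is the projection of $\mathrm{in}(t)$ to the product over the leaves of $T$ above the edge $\alpha(m)$, followed by the morphism to $t(\alpha(m))$ that $t$ assigns to the subtree of $T$ above $\alpha(m)$. For a functor $X$ from $\mathbb S^{op}$ to dendroidal sets, the dendroidal Grothendieck construction $\int_{\mathbb S}X$ is the dendroidal set whose dendrices of shape $T$ are the pairs $(t,x)$, where $t\in N_d(\mathbb S)_T$ and $x$ assigns to each map $r:R\to T$ in $\Omega$ an element $x(r)\in X(\mathrm{in}(r^*t))_R$ such that $$\alpha^*(x(r))=X(\mathrm{in}(\alpha))(x(r\alpha))\in X(\mathrm{in}(r^*t))_{R'}$$ for all maps $R'\xrightarrow{\alpha}R\xrightarrow{r}T$; a map $\delta:R\to T$ acts by $\delta^*(t,x)=(\delta^*t,\ r\mapsto x(\delta r))$. Proposition. Let $\mathbb S$ be a category with finite products, $X$ a functor from $\mathbb S^{op}$ to dendroidal sets, and $k\ge 2$ a natural number. If $X(s)$ is $k$-coskeletal for every object $s$ of $\mathbb S$, then $\int_{\mathbb S}X$ is $k$-coskeletal. -/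

import Mathlib

open CategoryTheory CategoryTheory.Limits Opposite

universe u v w u₁ v₁ u₂ v₂ u₃ v₃

namespace Dendroidal

/-! ### Symmetric coloured operads -/

/-- A symmetric coloured operad in sets (symmetric multicategory). The inputs of an operation are
indexed by an arbitrary finite set `I` instead of `{1, …, n}`, so that the symmetric group actions
become an action `reindex` of all bijections between finite sets. -/
structure ColOperad where
  /-- the colours (objects) -/
  Col : Type u
  /-- `Op c d` is the set of operations with inputs `c i`, `i ∈ I`, and output `d` -/
  Op : ∀ {I : Type} [Finite I], (I → Col) → Col → Type v
  /-- the identity operations -/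
  one : ∀ a : Col, Op (fun _ : Unit => a) a
  /-- the action of bijections on the inputs -/
  reindex : ∀ {I J : Type} [Finite I] [Finite J] (e : J ≃ I) {c : I → Col} {d : Col},
    Op c d → Op (fun j => c (e j)) d
  /-- composition: plug an operation into each of the inputs -/
  comp : ∀ {I : Type} [Finite I] {J : I → Type} [∀ i, Finite (J i)] {c : I → Col} {d : Col}
    {b : ∀ i, J i → Col}, Op c d → (∀ i, Op (b i) (c i)) →
      Op (fun p : Σ i, J i => b p.1 p.2) d
  reindex_refl : ∀ {I : Type} [Finite I] {c : I → Col} {d : Col} (p : Op c d),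
    reindex (Equiv.refl I) p = p
  reindex_trans : ∀ {I J K : Type} [Finite I] [Finite J] [Finite K] (f : K ≃ J) (e : J ≃ I)
    {c : I → Col} {d : Col} (p : Op c d), reindex f (reindex e p) = reindex (f.trans e) p
  /-- equivariance of the composition in the outer operation -/
  comp_reindex : ∀ {I I' : Type} [Finite I] [Finite I'] (e : I' ≃ I) {J : I → Type}
    [∀ i, Finite (J i)] {c : I → Col} {d : Col} {b : ∀ i, J i → Col} (p : Op c d)
    (q : ∀ i, Op (b i) (c i)),
    comp (reindex e p) (fun i' => q (e i')) =
      reindex (Equiv.sigmaCongrLeft (β := J) e) (comp p q)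
  /-- equivariance of the composition in the inner operations -/
  comp_reindex' : ∀ {I : Type} [Finite I] {J J' : I → Type} [∀ i, Finite (J i)]
    [∀ i, Finite (J' i)] (e : ∀ i, J' i ≃ J i) {c : I → Col} {d : Col} {b : ∀ i, J i → Col}
    (p : Op c d) (q : ∀ i, Op (b i) (c i)),
    comp p (fun i => reindex (e i) (q i)) = reindex (Equiv.sigmaCongrRight e) (comp p q)
  one_comp : ∀ {I : Type} [Finite I] {c : I → Col} {d : Col} (p : Op c d),
    comp (one d) (fun _ => p) = reindex (Equiv.uniqueSigma fun _ : Unit => I) p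
  comp_one : ∀ {I : Type} [Finite I] {c : I → Col} {d : Col} (p : Op c d),
    comp p (fun i => one (c i)) = reindex (Equiv.sigmaPUnit I) p
  assoc : ∀ {I : Type} [Finite I] {J : I → Type} [∀ i, Finite (J i)] {K : ∀ i, J i → Type}
    [∀ i j, Finite (K i j)] {c : I → Col} {d : Col} {b : ∀ i, J i → Col}
    {a : ∀ i j, K i j → Col} (p : Op c d) (q : ∀ i, Op (b i) (c i))
    (r : ∀ i j, Op (a i j) (b i j)),
    comp (comp p q) (fun s => r s.1 s.2) =
      reindex (Equiv.sigmaAssoc K) (comp p fun i => comp (q i) (r i))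

/-- Maps of symmetric coloured operads. -/
@[ext]
structure OperadHom (P : ColOperad.{u₁, v₁}) (Q : ColOperad.{u₂, v₂}) where
  /-- the map on colours -/
  col : P.Col → Q.Col
  /-- the map on operations -/
  op : ∀ {I : Type} [Finite I] {c : I → P.Col} {d : P.Col},
    P.Op c d → Q.Op (fun i => col (c i)) (col d)
  map_one : ∀ a, op (P.one a) = Q.one (col a)
  map_reindex : ∀ {I J : Type} [Finite I] [Finite J] (e : J ≃ I) {c : I → P.Col} {d : P.Col}
    (p : P.Op c d), op (P.reindex e p) = Q.reindex e (op p)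
  map_comp : ∀ {I : Type} [Finite I] {J : I → Type} [∀ i, Finite (J i)] {c : I → P.Col}
    {d : P.Col} {b : ∀ i, J i → P.Col} (p : P.Op c d) (q : ∀ i, P.Op (b i) (c i)),
    op (P.comp p q) = Q.comp (op p) (fun i => op (q i))

/-- The identity map of an operad. -/
def OperadHom.id (P : ColOperad.{u₁, v₁}) : OperadHom P P where
  col a := a
  op p := p
  map_one _ := rfl
  map_reindex _ _ _ _ := rfl
  map_comp _ _ := rfl

/-- Composition of operad maps (in diagrammatic order). -/
def OperadHom.comp {P : ColOperad.{u₁, v₁}} {Q : ColOperad.{u₂, v₂}} {R : ColOperad.{u₃, v₃}}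
    (f : OperadHom P Q) (g : OperadHom Q R) : OperadHom P R where
  col a := g.col (f.col a)
  op p := g.op (f.op p)
  map_one a := by rw [f.map_one, g.map_one]
  map_reindex e _ _ p := by rw [f.map_reindex, g.map_reindex]
  map_comp p q := by rw [f.map_comp, g.map_comp]

/-! ### Trees -/

/-- A finite non-planar rooted tree, with open edges allowed: `out v` is the outgoing edge of the
vertex `v`, and `down e = some v` says that `e` is an incoming edge of `v`. Every edge is the
outgoing edge of at most one vertex and, unless it is the root, an incoming edge of exactly one.
The last axiom says that walking down from any edge one reaches the root, so the graph is
connected and has no cycles. -/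
structure RTree where
  /-- the edges -/
  E : Type
  /-- the vertices -/
  V : Type
  finE : Finite E
  finV : Finite V
  /-- the root edge -/
  root : E
  /-- the outgoing edge of a vertex -/
  out : V → E
  /-- the vertex of which an edge is an incoming edge, if there is one -/
  down : E → Option V
  out_injective : Function.Injective out
  down_eq_none : ∀ e, down e = none ↔ e = root
  reach : ∀ e, Relation.ReflTransGen (fun a b => ∃ v, down a = some v ∧ out v = b) e root

namespace RTree

instance (T : RTree) : Finite T.E := T.finE

instance (T : RTree) : Finite T.V := T.finV

/-- `a` is an incoming edge, and `b` the outgoing edge, of one and the same vertex. -/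
def Step (T : RTree) (a b : T.E) : Prop := ∃ v, T.down a = some v ∧ T.out v = b

/-- The edge `b` lies on the path from `a` to the root (possibly `a = b`). -/
def Above (T : RTree) (a b : T.E) : Prop := Relation.ReflTransGen T.Step a b

/-- The leaves are the edges without a vertex on top; the root is a leaf only if the tree has no
vertex. -/
def IsLeaf (T : RTree) (e : T.E) : Prop := ∀ v, T.out v ≠ e

/-- The set of leaves. -/
abbrev Leaves (T : RTree) : Type := {l : T.E // T.IsLeaf l}

/-- The leaves above a given edge. -/
abbrev LeavesAbove (T : RTree) (e : T.E) : Type := {l : T.E // T.IsLeaf l ∧ T.Above l e}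

/-- The incoming edges of a vertex. -/
abbrev Inputs (T : RTree) (v : T.V) : Type := {e : T.E // T.down e = some v}

/-- The signatures of the operations that are generated by the vertices of `T`, a vertex being an
operation from its incoming edges to its outgoing edge. -/
inductive IsOp (T : RTree) : ∀ {I : Type}, (I → T.E) → T.E → Prop
  | one (e : T.E) : IsOp T (fun _ : Unit => e) e
  | vertex (v : T.V) : IsOp T (fun e : T.Inputs v => e.1) (T.out v)
  | reindex {I J : Type} (e : J ≃ I) {c : I → T.E} {d : T.E} :
      IsOp T c d → IsOp T (fun j => c (e j)) d
  | comp {I : Type} {J : I → Type} {c : I → T.E} {d : T.E} {b : ∀ i, J i → T.E} :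
      IsOp T c d → (∀ i, IsOp T (b i) (c i)) → IsOp T (fun p : Σ i, J i => b p.1 p.2) d

/-- The operad `Ω(T)` freely generated by the vertices of `T`. Its colours are the edges. As the
edges of a tree are pairwise distinct, an operation is determined by its inputs and its output:
`Ω(T)(c; d)` has one element if the signature `(c; d)` is generated by the vertices of `T`, that
is, if `T` has a subtree with set of leaves `c` and root `d`, and it is empty otherwise. -/
def operad (T : RTree) : ColOperad.{0, 0} where
  Col := T.E
  Op c d := PLift (T.IsOp c d)
  one e := ⟨IsOp.one e⟩
  reindex e _ _ p := ⟨IsOp.reindex e p.down⟩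
  comp p q := ⟨IsOp.comp p.down fun i => (q i).down⟩
  reindex_refl _ := rfl
  reindex_trans _ _ _ _ _ := rfl
  comp_reindex _ _ _ _ _ _ _ _ := rfl
  comp_reindex' _ _ _ _ _ _ := rfl
  one_comp _ := rfl
  comp_one _ := rfl
  assoc _ _ _ := rfl

/-- The category `Ω` of trees: a map of trees is a map of the operads they generate. -/
instance : Category.{1} RTree where
  Hom R T := OperadHom R.operad T.operad
  id T := OperadHom.id T.operad
  comp f g := f.comp g

theorem step_det (T : RTree) {a b b' : T.E} (h : T.Step a b) (h' : T.Step a b') : b = b' := by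
  obtain ⟨v, hv, rfl⟩ := h
  obtain ⟨v', hv', rfl⟩ := h'
  rw [hv] at hv'
  cases hv'
  rfl

theorem not_transGen_self (T : RTree) (e : T.E) : ¬ Relation.TransGen T.Step e e := by
  have h : Relation.ReflTransGen T.Step e T.root := T.reach e
  induction h using Relation.ReflTransGen.head_induction_on with
  | refl =>
    intro h
    obtain ⟨b, ⟨v, hv, -⟩, -⟩ := Relation.TransGen.head'_iff.1 h
    rw [(T.down_eq_none _).2 rfl] at hv
    cases hv
  | head hab _ ih =>
    intro h
    obtain ⟨b, hb, hba⟩ := Relation.TransGen.head'_iff.1 h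
    cases T.step_det hab hb
    exact ih (Relation.TransGen.tail' hba hab)

theorem step_wf (T : RTree) : WellFounded T.Step := by
  have : Std.Irrefl (Relation.TransGen T.Step) := ⟨T.not_transGen_self⟩
  exact Subrelation.wf (fun h => Relation.TransGen.single h)
    (Finite.wellFounded_of_trans_of_irrefl (Relation.TransGen T.Step))

/-- For every edge `e` of a tree, the subtree above `e` is an operation from the leaves above `e`
to `e`. -/
theorem isOp_leavesAbove (T : RTree) (e : T.E) :
    T.IsOp (fun l : T.LeavesAbove e => l.1) e := by
  induction e using T.step_wf.induction with
  | _ e ih =>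
    by_cases he : T.IsLeaf e
    · have huniq : ∀ l : T.LeavesAbove e, l.1 = e := by
        rintro ⟨l, hl, hle⟩
        rcases Relation.ReflTransGen.cases_tail hle with h | ⟨b, -, v, -, hv⟩
        · exact h.symm
        · exact absurd hv (he v)
      have := IsOp.reindex (T := T) (I := Unit) (J := T.LeavesAbove e)
        ⟨fun _ => (), fun _ => ⟨e, he, .refl⟩, fun l => Subtype.ext (huniq l).symm,
          fun _ => rfl⟩ (IsOp.one e)
      convert this with l
      exact huniq l
    · obtain ⟨v, rfl⟩ : ∃ v, T.out v = e := by simpa [IsLeaf] using he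
      have hc := IsOp.comp (IsOp.vertex v) (fun i => ih i.1 ⟨v, i.2, rfl⟩)
      let f : (Σ i : T.Inputs v, T.LeavesAbove i.1) → T.LeavesAbove (T.out v) :=
        fun p => ⟨p.2.1, p.2.2.1, p.2.2.2.tail ⟨v, p.1.2, rfl⟩⟩
      have hf : Function.Bijective f := by
        constructor
        · rintro ⟨⟨a, ha⟩, l, hl, hla⟩ ⟨⟨a', ha'⟩, l', hl', hla'⟩ h
          obtain rfl : l = l' := congrArg Subtype.val h
          have key : ∀ {x y : T.E}, T.down x = some v → T.down y = some v →
              Relation.ReflTransGen T.Step x y → x = y := by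
            intro x y hx hy hxy
            rcases Relation.ReflTransGen.cases_head hxy with h | ⟨b, hb, hby⟩
            · exact h
            · cases T.step_det hb ⟨v, hx, rfl⟩
              exact absurd (Relation.TransGen.tail' hby ⟨v, hy, rfl⟩)
                (T.not_transGen_self _)
          obtain rfl : a = a' := by
            rcases Relation.ReflTransGen.total_of_right_unique
              (r := T.Step) (fun _ _ _ h h' => T.step_det h h') hla hla' with h | h
            · exact key ha ha' h
            · exact (key ha' ha h).symm
          rfl
        · rintro ⟨l, hl, hla⟩
          rcases Relation.ReflTransGen.cases_tail hla with h | ⟨b, hlb, v', hb, hv⟩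
          · exact absurd h (hl v)
          · cases T.out_injective hv
            exact ⟨⟨⟨b, hb⟩, l, hl, hlb⟩, rfl⟩
      have := IsOp.reindex (Equiv.ofBijective f hf).symm hc
      have hfun : (fun l : T.LeavesAbove (T.out v) => l.1) = fun l =>
          ((Equiv.ofBijective f hf).symm l).2.1 := funext fun l =>
        (congrArg Subtype.val ((Equiv.ofBijective f hf).apply_symm_apply l)).symm
      rw [hfun]
      exact this

/-- The operation of `Ω(T)` given by the subtree of `T` above the edge `e`. -/
def leafOp (T : RTree) (e : T.E) :
    T.operad.Op (fun l : T.LeavesAbove e => (l.1 : T.operad.Col)) e :=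
  ⟨T.isOp_leavesAbove e⟩

end RTree

/-! ### Dendroidal sets -/

/-- The category of dendroidal sets. -/
abbrev DSet := RTreeᵒᵖ ⥤ Type w

/-- The trees with at most `k` vertices. -/
def AtMostVertices (k : ℕ) : ObjectProperty RTree := fun T => Nat.card T.V ≤ k

/-- The inclusion of the full subcategory of trees with at most `k` vertices. -/
abbrev truncInclusion (k : ℕ) : (AtMostVertices k).FullSubcategory ⥤ RTree :=
  (AtMostVertices k).ι

/-- A dendroidal set `X` is `k`-coskeletal if it is, via the identity, the right Kan extension of
its own restriction to the trees with at most `k` vertices, i.e. if the canonical map from `X` to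
its `k`-coskeleton is an isomorphism. -/
def IsCoskeletal (k : ℕ) (X : DSet.{w}) : Prop :=
  X.IsRightKanExtension (𝟙 ((truncInclusion k).op ⋙ X))

/-- The dendroidal nerve `N_d(P)`, `N_d(P)_T = Op(Ω(T), P)`. -/
def nerve (P : ColOperad.{u, v}) : DSet.{max 1 u v} where
  obj T := OperadHom T.unop.operad P
  map f := ↾fun t => OperadHom.comp f.unop t

/-! ### The Grothendieck construction -/

section Grothendieck

variable {S : Type u} [Category.{v} S] [HasFiniteProducts S]

/-- The permutation of the factors of a product given by a bijection. -/
noncomputable def permMap {I J : Type} [Finite I] [Finite J] (e : J ≃ I) (c : I → S) :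
    (∏ᶜ fun j => c (e j)) ⟶ ∏ᶜ c :=
  (Pi.reindex e c).hom

theorem permMap_π {I J : Type} [Finite I] [Finite J] (e : J ≃ I) (c : I → S) (j : J) :
    permMap e c ≫ Pi.π c (e j) = Pi.π (fun j => c (e j)) j :=
  Pi.reindex_hom_π e c j

/-- The projection of an iterated product to one of its blocks. -/
noncomputable def blockMap {I : Type} [Finite I] {J : I → Type} [∀ i, Finite (J i)]
    (b : ∀ i, J i → S) (i : I) : (∏ᶜ fun s : Σ i, J i => b s.1 s.2) ⟶ ∏ᶜ b i :=
  Pi.lift fun j => Pi.π (fun s : Σ i, J i => b s.1 s.2) ⟨i, j⟩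

theorem blockMap_π {I : Type} [Finite I] {J : I → Type} [∀ i, Finite (J i)]
    (b : ∀ i, J i → S) (i : I) (j : J i) :
    blockMap b i ≫ Pi.π (b i) j = Pi.π (fun s : Σ i, J i => b s.1 s.2) ⟨i, j⟩ := by
  simp [blockMap]

/-- The product of the morphisms `q i : ∏ⱼ b i j ⟶ c i`. -/
noncomputable def graftMap {I : Type} [Finite I] {J : I → Type} [∀ i, Finite (J i)] {c : I → S}
    {b : ∀ i, J i → S} (q : ∀ i, ∏ᶜ b i ⟶ c i) :
    (∏ᶜ fun s : Σ i, J i => b s.1 s.2) ⟶ ∏ᶜ c :=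
  Pi.lift fun i => blockMap b i ≫ q i

theorem graftMap_π {I : Type} [Finite I] {J : I → Type} [∀ i, Finite (J i)] {c : I → S}
    {b : ∀ i, J i → S} (q : ∀ i, ∏ᶜ b i ⟶ c i) (i : I) :
    graftMap q ≫ Pi.π c i = blockMap b i ≫ q i := by
  simp [graftMap]

variable (S) in
/-- A category with finite products as an operad: the operations from `c i`, `i ∈ I`, to `d` are
the morphisms `∏ c i ⟶ d`. -/
noncomputable def cartesianOperad : ColOperad.{u, v} where
  Col := S
  Op c d := ∏ᶜ c ⟶ d
  one a := Pi.π (fun _ : Unit => a) ()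
  reindex e c _ p := permMap e c ≫ p
  comp p q := graftMap q ≫ p
  reindex_refl {I _ c d} p := by
    refine Eq.trans ?_ (Category.id_comp p)
    congr 1
    refine Pi.hom_ext _ _ fun i => ?_
    exact (permMap_π (Equiv.refl I) c i).trans (Category.id_comp _).symm
  reindex_trans {I J K _ _ _} f e {c d} p := by
    refine (Category.assoc _ _ _).symm.trans ?_
    congr 1
    refine Pi.hom_ext _ _ fun i => ?_
    obtain ⟨k, rfl⟩ := (f.trans e).surjective i
    refine Eq.trans ?_ (permMap_π (f.trans e) c k).symm
    refine (Category.assoc _ _ _).trans ?_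
    refine Eq.trans (congrArg _ (permMap_π e c (f k))) ?_
    exact permMap_π f (fun j => c (e j)) k
  comp_reindex {I I' _ _} e {J _ c d b} p q := by
    refine (Category.assoc _ _ _).symm.trans (Eq.trans ?_ (Category.assoc _ _ _))
    congr 1
    refine Pi.hom_ext _ _ fun i => ?_
    obtain ⟨k, rfl⟩ := e.surjective i
    refine (Category.assoc _ _ _).trans (Eq.trans ?_ (Category.assoc _ _ _).symm)
    refine (congrArg _ (permMap_π e c k)).trans ?_
    refine (graftMap_π _ _).trans ?_
    refine Eq.trans ?_ (congrArg _ (graftMap_π q (e k))).symm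
    refine Eq.trans ?_ (Category.assoc _ _ _)
    congr 1
    refine Pi.hom_ext _ _ fun j => ?_
    refine (blockMap_π _ _ _).trans (Eq.trans ?_ (Category.assoc _ _ _).symm)
    refine Eq.trans ?_ (congrArg _ (blockMap_π b (e k) j)).symm
    exact (permMap_π (Equiv.sigmaCongrLeft (β := J) e) (fun s : Σ i, J i => b s.1 s.2)
      (⟨k, j⟩ : Σ i', J (e i'))).symm
  comp_reindex' {I _ J J' _ _} e {c d b} p q := by
    refine Eq.trans ?_ (Category.assoc _ _ _)
    congr 1
    refine Pi.hom_ext _ _ fun i => ?_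
    refine (graftMap_π _ _).trans (Eq.trans ?_ (Category.assoc _ _ _).symm)
    refine Eq.trans ?_ (congrArg _ (graftMap_π q i)).symm
    refine (Category.assoc _ _ _).symm.trans (Eq.trans ?_ (Category.assoc _ _ _))
    congr 1
    refine Pi.hom_ext _ _ fun j => ?_
    obtain ⟨k, rfl⟩ := (e i).surjective j
    refine (Category.assoc _ _ _).trans (Eq.trans ?_ (Category.assoc _ _ _).symm)
    refine (congrArg _ (permMap_π (e i) (b i) k)).trans ?_
    refine (blockMap_π _ _ _).trans ?_
    refine Eq.trans ?_ (congrArg _ (blockMap_π b i (e i k))).symm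
    exact (permMap_π (Equiv.sigmaCongrRight e) (fun s : Σ i, J i => b s.1 s.2)
      (⟨i, k⟩ : Σ i, J' i)).symm
  one_comp {I _ c d} p := by
    refine (graftMap_π (c := fun _ : Unit => d) (fun _ => p) ()).trans ?_
    congr 1
    refine Pi.hom_ext _ _ fun i => ?_
    refine (blockMap_π _ _ _).trans ?_
    exact (permMap_π (Equiv.uniqueSigma fun _ : Unit => I) c ⟨(), i⟩).symm
  comp_one {I _ c d} p := by
    congr 1
    refine Pi.hom_ext _ _ fun i => ?_
    refine (graftMap_π _ _).trans ?_
    refine (blockMap_π (fun i (_ : Unit) => c i) i ()).trans ?_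
    exact (permMap_π (Equiv.sigmaPUnit I) c ⟨i, ()⟩).symm
  assoc {I _ J _ K _ c d b a} p q r := by
    refine (Category.assoc _ _ _).symm.trans (Eq.trans ?_ (Category.assoc _ _ _))
    congr 1
    refine Pi.hom_ext _ _ fun i => ?_
    refine (Category.assoc _ _ _).trans (Eq.trans ?_ (Category.assoc _ _ _).symm)
    refine (congrArg _ (graftMap_π q i)).trans ?_
    refine Eq.trans ?_ (congrArg _ (graftMap_π (fun i => graftMap (r i) ≫ q i) i)).symm
    refine (Category.assoc _ _ _).symm.trans ?_
    refine Eq.trans ?_ (congrArg _ (Category.assoc _ _ _))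
    refine Eq.trans ?_ (Category.assoc _ _ _)
    congr 1
    refine Pi.hom_ext _ _ fun j => ?_
    refine (Category.assoc _ _ _).trans (Eq.trans ?_ (Category.assoc _ _ _).symm)
    refine (congrArg _ (blockMap_π b i j)).trans ?_
    refine (graftMap_π _ _).trans ?_
    refine Eq.trans ?_ (congrArg _ (Category.assoc _ _ _).symm)
    refine Eq.trans ?_ (congrArg _ (congrArg _ (graftMap_π (r i) j).symm))
    refine Eq.trans ?_ (congrArg _ (Category.assoc _ _ _))
    refine Eq.trans ?_ (Category.assoc _ _ _)
    congr 1
    refine Pi.hom_ext _ _ fun k => ?_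
    refine (blockMap_π _ _ _).trans (Eq.trans ?_ (Category.assoc _ _ _).symm)
    refine Eq.trans ?_ (congrArg _ (Category.assoc _ _ _).symm)
    refine Eq.trans ?_ (congrArg _ (congrArg _ (blockMap_π (a i) j k).symm))
    refine Eq.trans ?_ (congrArg _ (blockMap_π (fun i (s : Σ j, K i j) => a i s.1 s.2) i
      ⟨j, k⟩).symm)
    exact (permMap_π (Equiv.sigmaAssoc K) (fun s => a s.1 s.2.1 s.2.2) ⟨⟨i, j⟩, k⟩).symm

/-- A dendrex `t` of shape `T` in the nerve of `S`, restricted along a map of trees. -/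
noncomputable abbrev restr {R T : RTree} (r : R ⟶ T)
    (t : OperadHom T.operad (cartesianOperad S)) : OperadHom R.operad (cartesianOperad S) :=
  OperadHom.comp r t

/-- The object of `S` by which `t` labels an edge. -/
abbrev label {T : RTree} (t : OperadHom T.operad (cartesianOperad S)) (e : T.E) : S := t.col e

/-- `in(t)`: the product of the objects of `S` by which `t` labels the leaves of `T`. -/
noncomputable def inn {T : RTree} (t : OperadHom T.operad (cartesianOperad S)) : S :=
  ∏ᶜ fun l : T.Leaves => label t l.1

/-- The morphism of `S` that `t` assigns to the subtree of `T` above the edge `e`. -/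
noncomputable def subtreeMap {T : RTree} (t : OperadHom T.operad (cartesianOperad S)) (e : T.E) :
    (∏ᶜ fun l : T.LeavesAbove e => label t l.1) ⟶ label t e :=
  t.op (T.leafOp e)

/-- `in(α) : in(t) ⟶ in(α^* t)`. Its component at a leaf `m` of `R` is the projection to the
leaves of `T` above the edge `α(m)`, followed by the composite along the subtree of `T` above
`α(m)` of the operations by which `t` labels the vertices. -/
noncomputable def innMap {R T : RTree} (α : R ⟶ T)
    (t : OperadHom T.operad (cartesianOperad S)) : inn t ⟶ inn (restr α t) :=
  Pi.lift fun m : R.Leaves =>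
    (Pi.lift fun l : T.LeavesAbove (OperadHom.col α m.1) =>
      Pi.π (fun l : T.Leaves => label t l.1) ⟨l.1, l.2.1⟩) ≫
    subtreeMap t (OperadHom.col α m.1)

/-- The dendrices of shape `T` of the Grothendieck construction of `X`. -/
@[ext]
structure GrothDendrex (X : Sᵒᵖ ⥤ DSet.{w}) (T : RTree) where
  /-- a dendrex of shape `T` in the nerve of `S` -/
  t : (nerve (cartesianOperad S)).obj (op T)
  /-- a degree preserving map `x : Ω[T] → ∐ₛ X(s)` with `x(r) ∈ X(in(r^* t))` -/
  x : ∀ {R : RTree} (r : R ⟶ T), (X.obj (op (inn (restr r t)))).obj (op R)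
  compat : ∀ {R' R : RTree} (α : R' ⟶ R) (r : R ⟶ T),
    (X.obj (op (inn (restr r t)))).map α.op (x r) =
      (X.map (innMap α (restr r t)).op).app (op R') (x (α ≫ r))

/-- The dendroidal Grothendieck construction `∫_S X`; a map `δ : R ⟶ T` acts by
`δ^*(t, x) = (δ^* t, x ∘ Ω[δ])`. -/
noncomputable def groth (X : Sᵒᵖ ⥤ DSet.{w}) : DSet.{max 1 u v w} where
  obj T := GrothDendrex X T.unop
  map δ := ↾fun y =>
    { t := (nerve (cartesianOperad S)).map δ y.t
      x := fun r => y.x (r ≫ δ.unop)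
      compat := fun α r => y.compat α (r ≫ δ.unop) }

end Grothendieck

end Dendroidal

namespace Dendroidal

/-! ### Coskeletal dendroidal sets via matching families -/

/-! Being `k`-coskeletal amounts to unique gluing: every compatible family of elements indexed by
the maps `r : R ⟶ T` from trees `R` with at most `k` vertices (small trees) comes from exactly one
dendrex of shape `T` (`IsCoskeletal.existsUnique`, `isCoskeletal_of_existsUnique`). So a matching
family of pairs `(t_r, x_r)` in the Grothendieck construction has to be glued.

The `t_r` are glued in the nerve. The tree without vertices provides the labels of edges, and
corollas provide the morphisms assigned to operations. Only compatibility with composition needs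
more: filling all inputs of an operation is a succession of graftings at a single input, and each of
these is visible on a tree with two vertices (`Evaluates.graft`, `opMap_comp`). This is where `2 ≤
k` enters.

Once `t` is known, the value at `r : R ⟶ T` must restrict along `a : A ⟶ R`, `A` small, to the image
under `X(in(a))` of the component of `x_{ra}` at the identity of `A`. These elements match because
`in` is functorial (`innMap_comp`), so coskeletality of `X(in(r^* t))` yields exactly one value.
Compatibility, the gluing property and uniqueness are then all tested on small trees. Functoriality
of `in` says that the subtree above `α(e)` is the image of the subtree above `e` with the subtrees
above the images of its leaves grafted on (`innMap_comp_innProj`). -/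

instance {T : RTree} {I : Type} [Finite I] (c : I → T.operad.Col) (d : T.operad.Col) :
    Subsingleton (T.operad.Op c d) :=
  inferInstanceAs (Subsingleton (PLift (T.IsOp c d)))

theorem RTree.hom_ext {R T : RTree} {f g : R ⟶ T} (h : OperadHom.col f = OperadHom.col g) :
    f = g := by
  obtain ⟨cf, of, _, _, _⟩ := f
  obtain ⟨cg, og, _, _, _⟩ := g
  obtain rfl : cf = cg := h
  obtain rfl : @of = @og := by
    funext
    exact Subsingleton.elim _ _
  rfl

/-- The inputs of operations are indexed by arbitrary finite types, which puts the hom-sets in `Type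
1`. Smallness makes representables available with values in `Type w`, next to `X`. -/
instance : LocallySmall.{w} RTree where
  hom_small R T :=
    small_of_injective (β := R.E → T.E) (f := fun f : R ⟶ T => OperadHom.col f)
      fun _ _ h => RTree.hom_ext h

/-- A matching family for `X` on the trees over `T` with at most `k` vertices. -/
structure MatchingFamily (k : ℕ) (X : DSet.{w}) (T : RTree) where
  /-- the members of the family -/
  val : ∀ {R : RTree}, AtMostVertices k R → (R ⟶ T) → X.obj (op R)
  map_val : ∀ {R' R : RTree} (h' : AtMostVertices k R') (h : AtMostVertices k R) (α : R' ⟶ R)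
    (r : R ⟶ T), X.map α.op (val h r) = val h' (α ≫ r)

/-- `z` restricts to all the members of a matching family. -/
def MatchingFamily.IsGlued {k : ℕ} {X : DSet.{w}} {T : RTree} (y : MatchingFamily k X T)
    (z : X.obj (op T)) : Prop :=
  ∀ {R : RTree} (h : AtMostVertices k R) (r : R ⟶ T), X.map r.op z = y.val h r

/-- A matching family is a natural transformation from the restricted representable of `T` to the
restriction of `X`. It extends uniquely by the Kan extension property, and the Yoneda lemma turns
the extension into an element. -/
theorem IsCoskeletal.existsUnique {k : ℕ} {X : DSet.{w}} (hX : IsCoskeletal k X) {T : RTree}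
    (y : MatchingFamily k X T) : ∃! z, y.IsGlued z := by
  have : X.IsRightKanExtension (𝟙 ((truncInclusion k).op ⋙ X)) := hX
  let β : (truncInclusion k).op ⋙ shrinkYoneda.{w}.obj T ⟶ (truncInclusion k).op ⋙ X :=
    { app := fun R => ↾fun f => y.val R.unop.property (shrinkYonedaObjObjEquiv f)
      naturality := fun R R' α => by
        ext f
        have := shrinkYonedaObjObjEquiv_obj_map.{w} (X := T) α.unop.hom.op f
        have h2 := y.map_val R'.unop.property R.unop.property α.unop.hom
          (shrinkYonedaObjObjEquiv f)
        refine Eq.trans ?_ h2.symm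
        exact congrArg (y.val R'.unop.property) this }
  refine ⟨shrinkYonedaEquiv (X.liftOfIsRightKanExtension (𝟙 ((truncInclusion k).op ⋙ X)) _ β), ?_, ?_⟩
  · intro R h r
    have h1 := X.liftOfIsRightKanExtension_fac_app (𝟙 ((truncInclusion k).op ⋙ X)) _ β (op ⟨R, h⟩)
    have h2 := ConcreteCategory.congr_hom h1 (shrinkYonedaObjObjEquiv.symm r)
    rw [map_shrinkYonedaEquiv]
    refine Eq.trans h2 ?_
    change y.val h (shrinkYonedaObjObjEquiv (shrinkYonedaObjObjEquiv.symm r)) = _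
    rw [Equiv.apply_symm_apply]
  · intro z hz
    rw [← Equiv.symm_apply_eq]
    refine X.hom_ext_of_isRightKanExtension (𝟙 ((truncInclusion k).op ⋙ X)) _ _ ?_
    rw [X.liftOfIsRightKanExtension_fac]
    ext R f
    obtain ⟨f, rfl⟩ := shrinkYonedaObjObjEquiv.symm.surjective f
    change (shrinkYonedaEquiv.symm z).app _ (shrinkYonedaObjObjEquiv.symm f) =
      y.val _ (shrinkYonedaObjObjEquiv (shrinkYonedaObjObjEquiv.symm f))
    rw [shrinkYonedaEquiv_symm_app_shrinkYonedaObjObjEquiv_symm, Equiv.apply_symm_apply]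
    exact hz _ f

theorem isCoskeletal_of_existsUnique {k : ℕ} {X : DSet.{w}}
    (H : ∀ (T : RTree) (y : MatchingFamily k X T), ∃! z, y.IsGlued z) : IsCoskeletal k X := by
  -- Given a competitor `(G, β)`, an element `g` has small restrictions, which `β` carries to a
  -- matching family in `X`; its gluing is the only possible image of `g`.
  let y (G : DSet.{w}) (β : (truncInclusion k).op ⋙ G ⟶ (truncInclusion k).op ⋙ X) (T : RTree)
      (g : G.obj (op T)) : MatchingFamily k X T :=
    { val := fun {R} h r => β.app (op ⟨R, h⟩) (G.map r.op g)
      map_val := fun {R' R} h' h α r => by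
        have h1 := β.naturality (X := op ⟨R, h⟩) (Y := op ⟨R', h'⟩)
          (ObjectProperty.homMk α).op
        have h2 := ConcreteCategory.congr_hom h1 (G.map r.op g)
        refine Eq.trans h2.symm ?_
        change β.app (op ⟨R', h'⟩) (G.map α.op (G.map r.op g)) = _
        rw [op_comp, Functor.map_comp]
        rfl }
  refine ⟨⟨IsTerminal.ofUniqueHom (fun G => CostructuredArrow.homMk
    { app := fun T => ↾fun g => (H T.unop (y G.left G.hom T.unop g)).choose
      naturality := fun T T' f => ?_ } ?_) ?_⟩⟩
  · ext g
    refine (H T'.unop (y G.left G.hom T'.unop (G.left.map f g))).unique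
      (H T'.unop (y G.left G.hom T'.unop (G.left.map f g))).choose_spec.1 ?_
    intro R h r
    have h1 := (H T.unop (y G.left G.hom T.unop g)).choose_spec.1 h (r ≫ f.unop)
    change X.map r.op (X.map f _) = _
    rw [op_comp, Functor.map_comp] at h1
    refine Eq.trans h1 ?_
    change G.hom.app (op ⟨R, h⟩) (G.left.map (f ≫ r.op) g) =
      G.hom.app (op ⟨R, h⟩) (G.left.map r.op (G.left.map f g))
    rw [Functor.map_comp]
    rfl
  · ext R g
    -- Here `R` itself is small, so the gluing property applies to its identity map.
    have h1 := (H R.unop.obj (y G.left G.hom R.unop.obj g)).choose_spec.1 R.unop.property (𝟙 _)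
    rw [op_id, X.map_id] at h1
    refine Eq.trans h1 ?_
    change G.hom.app R (G.left.map (𝟙 _) g) = _
    rw [G.left.map_id]
    rfl
  · intro G m
    ext T g
    refine (H T.unop (y G.left G.hom T.unop g)).unique ?_
      (H T.unop (y G.left G.hom T.unop g)).choose_spec.1
    intro R h r
    have h1 := CostructuredArrow.w m
    have h2 := ConcreteCategory.congr_hom (NatTrans.congr_app h1 (op ⟨R, h⟩)) (G.left.map r.op g)
    refine Eq.trans ?_ h2
    exact (ConcreteCategory.congr_hom (m.left.naturality r.op) g).symm

/-! ### Operations of a tree -/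

namespace RTree

theorem IsOp.finite {T : RTree} {I : Type} {c : I → T.E} {d : T.E} (p : T.IsOp c d) :
    Finite I := by
  induction p with
  | one => infer_instance
  | vertex => infer_instance
  | reindex e _ ih => exact Finite.of_equiv _ e.symm
  | comp _ _ ih ih' => infer_instance

theorem IsOp.of_equiv {T : RTree} {I J : Type} {c : I → T.E} {c' : J → T.E} {d : T.E}
    (p : T.IsOp c d) (e : J ≃ I) (h : ∀ j, c' j = c (e j)) : T.IsOp c' d := by
  obtain rfl : c' = fun j => c (e j) := funext h
  exact p.reindex e

/-- A map on edges that sends every vertex to an operation preserves operations. -/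
theorem IsOp.map {R T : RTree} (f : R.E → T.E)
    (h : ∀ v, T.IsOp (fun e : R.Inputs v => f e.1) (f (R.out v))) {I : Type} {c : I → R.E}
    {d : R.E} (p : R.IsOp c d) : T.IsOp (fun i => f (c i)) (f d) := by
  induction p with
  | one e => exact .one (f e)
  | vertex v => exact h v
  | reindex e _ ih => exact ih.reindex e
  | comp _ _ ih ih' => exact ih.comp ih'

/-- The map of trees given by a map on edges that sends every vertex to an operation. -/
def homOfVertices {R T : RTree} (f : R.E → T.E)
    (h : ∀ v, T.IsOp (fun e : R.Inputs v => f e.1) (f (R.out v))) : R ⟶ T where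
  col := f
  op p := ⟨IsOp.map f h p.down⟩
  map_one _ := rfl
  map_reindex _ _ _ _ := rfl
  map_comp _ _ := rfl

theorem IsOp.above {T : RTree} {I : Type} {c : I → T.E} {d : T.E} (p : T.IsOp c d) (i : I) :
    T.Above (c i) d := by
  induction p with
  | one e => exact .refl
  | vertex v => exact .single ⟨v, i.2, rfl⟩
  | reindex e _ ih => exact ih _
  | comp _ _ ih ih' => exact (ih' _ _).trans (ih _)

/-- The path down from `x` continues with the output of `v`; if `y` were a later edge on it,
stepping from `y` to that output would close a cycle. -/
theorem inputs_eq_of_above {T : RTree} {v : T.V} {x y : T.E} (hx : T.down x = some v)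
    (hy : T.down y = some v) (hxy : T.Above x y) : x = y := by
  rcases Relation.ReflTransGen.cases_head hxy with h | ⟨b, hb, hby⟩
  · exact h
  · cases T.step_det hb ⟨v, hx, rfl⟩
    exact absurd (Relation.TransGen.tail' hby ⟨v, hy, rfl⟩) (T.not_transGen_self _)

/-- Every leaf above the output of an operation lies above exactly one of its inputs. -/
theorem IsOp.existsUnique_above {T : RTree} {I : Type} {c : I → T.E} {d : T.E} (p : T.IsOp c d)
    {l : T.E} (hl : T.IsLeaf l) (h : T.Above l d) : ∃! i, T.Above l (c i) := by
  induction p with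
  | one e => exact ⟨(), h, fun _ _ => rfl⟩
  | vertex v =>
    rcases Relation.ReflTransGen.cases_tail h with h | ⟨b, hlb, v', hb, hv⟩
    · exact absurd h (hl v)
    · cases T.out_injective hv
      refine ⟨⟨b, hb⟩, hlb, ?_⟩
      rintro ⟨a, ha⟩ hla
      refine Subtype.ext ?_
      -- The path down from `l` is unique, so two inputs on it are comparable.
      rcases Relation.ReflTransGen.total_of_right_unique
        (r := T.Step) (fun _ _ _ h h' => T.step_det h h') hla hlb with h | h
      · exact inputs_eq_of_above ha hb h
      · exact (inputs_eq_of_above hb ha h).symm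
  | reindex e _ ih =>
    obtain ⟨i, hi, hu⟩ := ih h
    exact ⟨e.symm i, by simpa using hi, fun j hj => e.eq_symm_apply.2 (hu _ hj)⟩
  | comp _ q ih ih' =>
    obtain ⟨i, hi, hu⟩ := ih h
    obtain ⟨j, hj, hu'⟩ := ih' i hi
    refine ⟨⟨i, j⟩, hj, ?_⟩
    rintro ⟨i', j'⟩ h'
    obtain rfl : i' = i := hu i' (Relation.ReflTransGen.trans h' ((q i').above j'))
    rw [hu' j' h']

/-- The leaves above the output of an operation, sorted by the inputs below them. -/
noncomputable def leavesAboveEquiv {T : RTree} {I : Type} {c : I → T.E} {d : T.E}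
    (p : T.IsOp c d) : (Σ i, T.LeavesAbove (c i)) ≃ T.LeavesAbove d :=
  Equiv.ofBijective (fun s => ⟨s.2.1, s.2.2.1, s.2.2.2.trans (p.above s.1)⟩) <| by
    constructor
    · rintro ⟨i, l, hl, hi⟩ ⟨i', l', hl', hi'⟩ h
      obtain rfl : l = l' := congrArg Subtype.val h
      obtain rfl : i = i' :=
        (p.existsUnique_above hl (hi.trans (p.above i))).unique hi hi'
      rfl
    · rintro ⟨l, hl, h⟩
      obtain ⟨i, hi, -⟩ := p.existsUnique_above hl h
      exact ⟨⟨i, l, hl, hi⟩, rfl⟩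

end RTree

/-! ### Generalized elements of products -/

section Lift

variable {S : Type u} [Category.{v} S] [HasFiniteProducts S] {Z : S}

theorem lift_π {I : Type} [Finite I] {c : I → S} (y : ∀ i, Z ⟶ c i) (i : I) :
    Pi.lift y ≫ Pi.π c i = y i := by
  simp

theorem comp_lift {Y : S} (f : Y ⟶ Z) {I : Type} [Finite I] {c : I → S} (y : ∀ i, Z ⟶ c i) :
    f ≫ Pi.lift y = Pi.lift fun i => f ≫ y i :=
  Pi.hom_ext _ _ fun i => by simp

theorem lift_proj {I : Type} [Finite I] (c : I → S) : Pi.lift (Pi.π c) = 𝟙 (∏ᶜ c) :=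
  Pi.hom_ext _ _ fun i => by simp

theorem lift_permMap {I J : Type} [Finite I] [Finite J] (e : J ≃ I) {c : I → S}
    (y : ∀ i, Z ⟶ c i) : Pi.lift (fun j => y (e j)) ≫ permMap e c = Pi.lift y := by
  refine Pi.hom_ext _ _ fun i => ?_
  obtain ⟨j, rfl⟩ := e.surjective i
  rw [Category.assoc, permMap_π, lift_π, lift_π]

theorem lift_graftMap {I : Type} [Finite I] {J : I → Type} [∀ i, Finite (J i)] {c : I → S}
    {b : ∀ i, J i → S} (q : ∀ i, ∏ᶜ b i ⟶ c i) (y : ∀ i j, Z ⟶ b i j) :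
    Pi.lift (fun s : Σ i, J i => y s.1 s.2) ≫ graftMap q =
      Pi.lift fun i => Pi.lift (y i) ≫ q i := by
  refine Pi.hom_ext _ _ fun i => ?_
  rw [Category.assoc, graftMap_π, lift_π, ← Category.assoc]
  congr 1
  refine Pi.hom_ext _ _ fun j => ?_
  rw [Category.assoc, blockMap_π, lift_π, lift_π]

end Lift

/-! ### Functoriality of `in` -/

section Inn

variable {S : Type u} [Category.{v} S] [HasFiniteProducts S]

/-- An operation of `T` is determined by its signature, so `p` is definitionally the reindexed
subtree operation. -/
theorem op_eq_permMap_subtreeMap {T : RTree} (t : OperadHom T.operad (cartesianOperad S))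
    {I : Type} [Finite I] {d : T.E} (e : I ≃ T.LeavesAbove d)
    (p : T.operad.Op (fun i => ((e i).1 : T.operad.Col)) d) :
    t.op p = permMap e (fun l : T.LeavesAbove d => label t l.1) ≫ subtreeMap t d :=
  t.map_reindex e (T.leafOp d)

/-- The projection of `in(t)` to the leaves above the edge `e`. -/
noncomputable def innProj {T : RTree} (t : OperadHom T.operad (cartesianOperad S)) (e : T.E) :
    inn t ⟶ ∏ᶜ fun l : T.LeavesAbove e => label t l.1 :=
  Pi.lift fun l : T.LeavesAbove e => Pi.π (fun l : T.Leaves => label t l.1) ⟨l.1, l.2.1⟩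

theorem innMap_π {R T : RTree} (α : R ⟶ T) (t : OperadHom T.operad (cartesianOperad S))
    (m : R.Leaves) :
    innMap α t ≫ Pi.π (fun l : R.Leaves => label (restr α t) l.1) m =
      innProj t (OperadHom.col α m.1) ≫ subtreeMap t (OperadHom.col α m.1) :=
  lift_π (c := fun l : R.Leaves => label (restr α t) l.1)
    (fun m => innProj t (OperadHom.col α m.1) ≫ subtreeMap t (OperadHom.col α m.1)) m

/-- Both sides evaluate the subtree of `T` above `α(e)`: the left one through the intermediate edges
`α(l)`, for `l` a leaf above `e`, the right one at once. -/
theorem innMap_comp_innProj {R T : RTree} (α : R ⟶ T)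
    (t : OperadHom T.operad (cartesianOperad S)) (e : R.E) :
    innMap α t ≫ innProj (restr α t) e ≫ subtreeMap (restr α t) e =
      innProj t (OperadHom.col α e) ≫ subtreeMap t (OperadHom.col α e) := by
  let p : T.operad.Op (fun l : R.LeavesAbove e => OperadHom.col α l.1) (OperadHom.col α e) :=
    OperadHom.op α (R.leafOp e)
  let E := RTree.leavesAboveEquiv p.down
  let q (l : R.LeavesAbove e) := T.leafOp (OperadHom.col α l.1)
  -- The composite of `p` with the `q l` has the leaves above `α(e)` as inputs, up to the bijection
  -- `E`, so it is the subtree operation.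
  have h1 : graftMap (fun l : R.LeavesAbove e => subtreeMap t (OperadHom.col α l.1)) ≫
      subtreeMap (restr α t) e =
      permMap E (fun l : T.LeavesAbove (OperadHom.col α e) => label t l.1) ≫
        subtreeMap t (OperadHom.col α e) :=
    (t.map_comp p q).symm.trans (op_eq_permMap_subtreeMap t E (T.operad.comp p q))
  let y (l : T.LeavesAbove (OperadHom.col α e)) : inn t ⟶ label t l.1 :=
    Pi.π (fun l : T.Leaves => label t l.1) ⟨l.1, l.2.1⟩
  have h2 : Pi.lift (fun s => y (E s)) ≫
      permMap E (fun l : T.LeavesAbove (OperadHom.col α e) => label t l.1) =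
      innProj t (OperadHom.col α e) :=
    lift_permMap E y
  have h3 : innMap α t ≫ innProj (restr α t) e = Pi.lift (fun s => y (E s)) ≫
      graftMap (fun l : R.LeavesAbove e => subtreeMap t (OperadHom.col α l.1)) := by
    refine (comp_lift _ _).trans (Eq.trans ?_ (lift_graftMap
      (fun l : R.LeavesAbove e => subtreeMap t (OperadHom.col α l.1))
      (fun l n => y (E ⟨l, n⟩))).symm)
    exact congrArg Pi.lift (funext fun l : R.LeavesAbove e => innMap_π α t ⟨l.1, l.2.1⟩)
  refine (Category.assoc _ _ _).symm.trans ?_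
  refine (congrArg (· ≫ subtreeMap (restr α t) e) h3).trans ?_
  refine (Category.assoc _ _ _).trans ?_
  refine (congrArg (Pi.lift (fun s => y (E s)) ≫ ·) h1).trans ?_
  refine (Category.assoc _ _ _).symm.trans ?_
  exact congrArg (· ≫ subtreeMap t (OperadHom.col α e)) h2

/-- For a leaf `m` of `Q` the edge `β(m)` need not be a leaf of `R`, which is why
`innMap_comp_innProj` treats arbitrary edges. -/
theorem innMap_comp {Q R T : RTree} (β : Q ⟶ R) (α : R ⟶ T)
    (t : OperadHom T.operad (cartesianOperad S)) :
    innMap (β ≫ α) t = innMap α t ≫ innMap β (restr α t) := by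
  refine Pi.hom_ext _ _ fun m => ?_
  refine (innMap_π (β ≫ α) t m).trans ?_
  refine Eq.trans ?_ (Category.assoc _ _ _).symm
  refine Eq.trans ?_ (congrArg (innMap α t ≫ ·) (innMap_π β (restr α t) m).symm)
  exact (innMap_comp_innProj α t _).symm

end Inn

/-! ### Small trees -/

namespace RTree

/-- The tree without vertices. -/
def eta : RTree where
  E := Unit
  V := Empty
  finE := inferInstance
  finV := inferInstance
  root := ()
  out := Empty.elim
  down _ := none
  out_injective v := v.elim
  down_eq_none _ := by simp
  reach _ := .refl

/-- The map from the tree without vertices that picks the edge `e`. -/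
def etaMap {T : RTree} (e : T.E) : eta ⟶ T :=
  homOfVertices (fun _ => e) fun v => v.elim

/-- The tree with one vertex and inputs `I`. -/
def corolla (I : Type) [Finite I] : RTree where
  E := Option I
  V := Unit
  finE := inferInstance
  finV := inferInstance
  root := none
  out _ := none
  down e := e.map fun _ => ()
  out_injective _ _ _ := rfl
  down_eq_none _ := by simp
  reach e := by
    cases e with
    | none => exact .refl
    | some i => exact .single ⟨(), rfl, rfl⟩

/-- The inputs of the vertex of a corolla. -/
noncomputable def corollaInputs (I : Type) [Finite I] : I ≃ (corolla I).Inputs () :=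
  Equiv.ofBijective (fun i => ⟨some i, rfl⟩) <| by
    constructor
    · intro i j h
      exact Option.some.inj (congrArg Subtype.val h)
    · rintro ⟨_ | i, h⟩
      · exact absurd h (Option.some_ne_none ()).symm
      · exact ⟨i, rfl⟩

theorem corolla_isOp (I : Type) [Finite I] :
    (corolla I).IsOp (fun i : I => (some i : Option I)) (none : Option I) :=
  (IsOp.vertex (T := corolla I) ()).of_equiv (corollaInputs I) fun _ => rfl

/-- The map from a corolla that picks an operation. -/
noncomputable def corollaMap {T : RTree} {I : Type} [Finite I] {c : I → T.E} {d : T.E}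
    (p : T.IsOp c d) : corolla I ⟶ T :=
  homOfVertices (R := corolla I) (fun e : Option I => e.elim d c) fun v =>
    p.of_equiv (corollaInputs I).symm fun e => by
      obtain ⟨i, rfl⟩ := (corollaInputs I).surjective e
      exact congrArg c ((corollaInputs I).symm_apply_apply i).symm

/-- The tree obtained by grafting a corolla with inputs `J` onto the input `none` of a corolla
with inputs `Option M`. -/
def graftTree (M J : Type) [Finite M] [Finite J] : RTree where
  E := Option (Option (M ⊕ J))
  V := Bool
  finE := inferInstance
  finV := inferInstance
  root := none
  out v := if v then some none else none
  down e := e.map fun e => e.elim false fun x => x.isRight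
  out_injective v v' h := by cases v <;> cases v' <;> simp_all
  down_eq_none _ := by simp
  reach e := by
    have h : Relation.ReflTransGen (fun a b : Option (Option (M ⊕ J)) => ∃ v,
        (a.map fun e => e.elim false fun x => x.isRight) = some v ∧
          (if v then some none else none) = b) (some none) none :=
      .single ⟨false, rfl, rfl⟩
    rcases e with _ | _ | m | j
    · exact .refl
    · exact h
    · exact .single ⟨false, rfl, rfl⟩
    · exact .head ⟨true, rfl, rfl⟩ h

/-- The operation is the subtree above the root, that is, the whole tree, whose leaves are exactly
the elements of `M ⊕ J`. -/
theorem graftTree_isOp (M J : Type) [Finite M] [Finite J] :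
    (graftTree M J).IsOp (fun x : M ⊕ J => (some (some x) : Option (Option (M ⊕ J))))
      (none : Option (Option (M ⊕ J))) := by
  let f (x : M ⊕ J) : (graftTree M J).LeavesAbove (none : Option (Option (M ⊕ J))) :=
    ⟨some (some x), fun v => by cases v <;> exact (by simp [graftTree]), (graftTree M J).reach _⟩
  have hf : Function.Bijective f := by
    constructor
    · intro x y h
      exact Option.some.inj (Option.some.inj (congrArg Subtype.val h))
    · rintro ⟨_ | _ | x, h, -⟩
      · exact absurd rfl (h false)
      · exact absurd rfl (h true)
      · exact ⟨x, rfl⟩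
  exact ((graftTree M J).isOp_leavesAbove _).of_equiv (Equiv.ofBijective f hf) fun _ => rfl

/-- The inputs of the lower vertex of `graftTree M J`. -/
noncomputable def graftTreeLower (M J : Type) [Finite M] [Finite J] :
    Option M ≃ (graftTree M J).Inputs false :=
  Equiv.ofBijective (fun o => ⟨some (o.map Sum.inl), by cases o <;> rfl⟩) <| by
    constructor
    · intro o o' h
      exact Option.map_injective Sum.inl_injective (Option.some.inj (congrArg Subtype.val h))
    · rintro ⟨_ | _ | m | j, h⟩
      · exact absurd h (Option.some_ne_none _).symm
      · exact ⟨none, rfl⟩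
      · exact ⟨some m, rfl⟩
      · exact absurd (Option.some.inj h) Bool.noConfusion

/-- The inputs of the upper vertex of `graftTree M J`. -/
noncomputable def graftTreeUpper (M J : Type) [Finite M] [Finite J] :
    J ≃ (graftTree M J).Inputs true :=
  Equiv.ofBijective (fun j => ⟨some (some (Sum.inr j)), rfl⟩) <| by
    constructor
    · intro j j' h
      exact Sum.inr_injective (Option.some.inj (Option.some.inj (congrArg Subtype.val h)))
    · rintro ⟨_ | _ | m | j, h⟩
      · exact absurd h (Option.some_ne_none _).symm
      · exact absurd (Option.some.inj h) Bool.noConfusion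
      · exact absurd (Option.some.inj h) Bool.noConfusion
      · exact ⟨j, rfl⟩

theorem atMostVertices_eta (k : ℕ) : AtMostVertices k eta :=
  (Nat.card_of_isEmpty (α := Empty)).trans_le k.zero_le

theorem atMostVertices_corolla {k : ℕ} (hk : 2 ≤ k) (I : Type) [Finite I] :
    AtMostVertices k (corolla I) :=
  (Nat.card_unique (α := Unit)).trans_le (by omega)

theorem atMostVertices_graftTree {k : ℕ} (hk : 2 ≤ k) (M J : Type) [Finite M] [Finite J] :
    AtMostVertices k (graftTree M J) :=
  (Nat.card_eq_fintype_card (α := Bool)).trans_le hk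

end RTree

/-! ### Changing an operad map along an equality of maps on colours -/

theorem OperadHom.op_heq {P : ColOperad.{u₁, v₁}} {Q : ColOperad.{u₂, v₂}} {f g : OperadHom P Q}
    (h : f = g) {I : Type} [Finite I] {c : I → P.Col} {d : P.Col} (p : P.Op c d) :
    HEq (f.op p) (g.op p) := by
  rw [h]

theorem OperadHom.ext_of_heq {P : ColOperad.{u₁, v₁}} {Q : ColOperad.{u₂, v₂}}
    {f g : OperadHom P Q} (h : f.col = g.col)
    (h' : ∀ {I : Type} [Finite I] {c : I → P.Col} {d : P.Col} (p : P.Op c d),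
      HEq (f.op p) (g.op p)) : f = g := by
  obtain ⟨cf, of, _, _, _⟩ := f
  obtain ⟨cg, og, _, _, _⟩ := g
  obtain rfl : cf = cg := h
  obtain rfl : @of = @og := by
    funext I _ c d p
    exact eq_of_heq (h' p)
  rfl

/-- An operad map with its map on colours replaced by an equal one. -/
def OperadHom.recol {P : ColOperad.{u₁, v₁}} {Q : ColOperad.{u₂, v₂}} (f : OperadHom P Q)
    (g : P.Col → Q.Col) (h : f.col = g) : OperadHom P Q where
  col := g
  op p := by subst h; exact f.op p
  map_one := by subst h; exact f.map_one
  map_reindex := by subst h; exact f.map_reindex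
  map_comp := by subst h; exact f.map_comp

theorem OperadHom.recol_eq {P : ColOperad.{u₁, v₁}} {Q : ColOperad.{u₂, v₂}}
    (f : OperadHom P Q) (g : P.Col → Q.Col) (h : f.col = g) : f.recol g h = f := by
  subst h
  rfl

/-! ### The nerve of a cartesian operad is 2-coskeletal -/

namespace MatchingFamily

variable {S : Type u} [Category.{v} S] [HasFiniteProducts S] {k : ℕ} {T : RTree}
  (y : MatchingFamily k (nerve (cartesianOperad S)) T)

/-- The label of an edge. -/
def colour (e : T.E) : S :=
  OperadHom.col (y.val (RTree.atMostVertices_eta k) (RTree.etaMap e)) ()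

/-- Restrict along the inclusion of each edge. The equality is only propositional, so the members
are recoloured by it below; afterwards the types of their operations agree definitionally. -/
theorem val_col {R : RTree} (h : AtMostVertices k R) (r : R ⟶ T) :
    OperadHom.col (y.val h r) = fun e => y.colour (OperadHom.col r e) := by
  funext e
  have h1 := y.map_val (RTree.atMostVertices_eta k) h (RTree.etaMap e) r
  have h2 : RTree.etaMap e ≫ r = RTree.etaMap (OperadHom.col r e) := RTree.hom_ext rfl
  rw [h2] at h1
  exact congrArg (fun f => OperadHom.col f ()) h1

/-- The members of the family, with colours given by `colour`. -/
noncomputable def localHom {R : RTree} (h : AtMostVertices k R) (r : R ⟶ T) :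
    OperadHom R.operad (cartesianOperad S) :=
  OperadHom.recol (y.val h r) (fun e => y.colour (OperadHom.col r e)) (y.val_col h r)

theorem localHom_eq {R : RTree} (h : AtMostVertices k R) (r : R ⟶ T) : y.localHom h r = y.val h r :=
  OperadHom.recol_eq _ _ _

theorem localHom_comp {R' R : RTree} (h' : AtMostVertices k R') (h : AtMostVertices k R)
    (α : R' ⟶ R) (r : R ⟶ T) : y.localHom h' (α ≫ r) = restr α (y.localHom h r) := by
  rw [localHom_eq, localHom_eq]
  exact (y.map_val h' h α r).symm

variable (hk : 2 ≤ k)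

/-- The morphism assigned to an operation of `T`. -/
noncomputable def opMap {I : Type} [Finite I] {c : I → T.E} {d : T.E} (p : T.IsOp c d) :
    (∏ᶜ fun i => y.colour (c i)) ⟶ y.colour d :=
  OperadHom.op (y.localHom (RTree.atMostVertices_corolla hk I) (RTree.corollaMap p))
    ⟨RTree.corolla_isOp I⟩

/-- The corolla picking the image of `p` in `T` factors through the corolla picking `p` in `R`, and
the family is compatible with that factorization. Identities about `opMap` can thus be read off
inside any small tree over `T`. -/
theorem localHom_op {R : RTree} (h : AtMostVertices k R) (r : R ⟶ T) {I : Type} [Finite I]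
    {c : I → R.E} {d : R.E} (p : R.operad.Op c d) :
    OperadHom.op (y.localHom h r) p = y.opMap hk (OperadHom.op r p).down := by
  have h1 : RTree.corollaMap (OperadHom.op r p).down = RTree.corollaMap p.down ≫ r :=
    RTree.hom_ext (funext fun e : Option I => by cases e <;> rfl)
  have h2 := (congrArg (y.localHom (RTree.atMostVertices_corolla hk I)) h1).trans
    (y.localHom_comp _ h (RTree.corollaMap p.down) r)
  exact (eq_of_heq (OperadHom.op_heq h2 ⟨RTree.corolla_isOp I⟩)).symm

theorem opMap_one (a : T.E) :
    y.opMap hk (RTree.IsOp.one a) = Pi.π (fun _ : Unit => y.colour a) () := by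
  refine (y.localHom_op hk (RTree.atMostVertices_eta k) (RTree.etaMap a)
    (RTree.eta.operad.one ())).symm.trans ?_
  exact OperadHom.map_one _ _

theorem opMap_reindex {I J : Type} [Finite I] [Finite J] (e : J ≃ I) {c : I → T.E} {d : T.E}
    (p : T.IsOp c d) :
    y.opMap hk (p.reindex e) = permMap e (fun i => y.colour (c i)) ≫ y.opMap hk p := by
  refine (y.localHom_op hk (RTree.atMostVertices_corolla hk I) (RTree.corollaMap p)
    ((RTree.corolla I).operad.reindex e ⟨RTree.corolla_isOp I⟩)).symm.trans ?_
  exact OperadHom.map_reindex _ _ _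

/-- The edges of `T` with a generalized element of their label. -/
abbrev Elt (Z : S) : Type v := Σ e : T.E, Z ⟶ y.colour e

/-- The morphism assigned to an operation of `T` sends the elements `η i` to `δ`. -/
def Evaluates {Z : S} {I : Type} (η : I → y.Elt Z) (δ : y.Elt Z) : Prop :=
  ∃ (_ : Finite I) (p : T.IsOp (fun i => (η i).1) δ.1),
    Pi.lift (fun i => (η i).2) ≫ y.opMap hk p = δ.2

variable {y hk} {Z : S}

/-- Since `Elt` bundles an edge with its element, pointwise equality of labellings replaces casts
between hom-sets; all the rearrangements of inputs below go through this lemma. -/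
theorem Evaluates.of_equiv {I J : Type} {η : I → y.Elt Z} {η' : J → y.Elt Z} {δ : y.Elt Z}
    (H : y.Evaluates hk η δ) (e : I ≃ J) (h : ∀ i, η' (e i) = η i) : y.Evaluates hk η' δ := by
  obtain ⟨_, p, hp⟩ := H
  have : Finite J := Finite.of_equiv _ e
  obtain rfl : η' = fun j => η (e.symm j) := funext fun j => by rw [← h, e.apply_symm_apply]
  refine ⟨this, p.reindex e.symm, (congrArg (_ ≫ ·) (y.opMap_reindex hk e.symm p)).trans ?_⟩
  refine (Category.assoc _ _ _).symm.trans ?_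
  exact (congrArg (· ≫ _) (lift_permMap e.symm fun i => (η i).2)).trans hp

/-- A labelling of the edges of a small tree that is compatible with the vertices is compatible
with all the operations. -/
theorem evaluates_of_vertices {R : RTree} (h : AtMostVertices k R) (L : R.E → y.Elt Z)
    (hL : ∀ v, y.Evaluates hk (fun e : R.Inputs v => L e.1) (L (R.out v))) {I : Type}
    {c : I → R.E} {d : R.E} (p : R.IsOp c d) : y.Evaluates hk (fun i => L (c i)) (L d) := by
  -- The edge parts of the labels form a map of trees. The member of the family at `r` is an operad
  -- map, so its effect on operations is determined by the vertices.
  let r : R ⟶ T := RTree.homOfVertices (fun e => (L e).1) fun v => (hL v).choose_spec.choose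
  have key : ∀ [Finite I], Pi.lift (fun i => (L (c i)).2) ≫
      OperadHom.op (y.localHom h r) (⟨p⟩ : R.operad.Op c d) = (L d).2 := by
    induction p with
    | one e =>
      intro _
      refine (congrArg (_ ≫ ·) ((y.localHom h r).map_one e)).trans ?_
      exact lift_π (fun _ : Unit => (L e).2) ()
    | vertex v =>
      intro _
      refine (congrArg (_ ≫ ·) (y.localHom_op hk h r _)).trans ?_
      exact (hL v).choose_spec.choose_spec
    | @reindex I J e c d p ih =>
      intro _
      have : Finite I := p.finite
      refine (congrArg (_ ≫ ·) ((y.localHom h r).map_reindex e ⟨p⟩)).trans ?_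
      refine (Category.assoc _ _ _).symm.trans ?_
      exact (congrArg (· ≫ _) (lift_permMap e fun i => (L (c i)).2)).trans ih
    | @comp I J c d b p q ih ih' =>
      intro _
      have : Finite I := p.finite
      have (i : I) : Finite (J i) := (q i).finite
      refine (congrArg (_ ≫ ·) ((y.localHom h r).map_comp ⟨p⟩ fun i => ⟨q i⟩)).trans ?_
      refine (Category.assoc _ _ _).symm.trans ?_
      refine (congrArg (· ≫ _) (lift_graftMap _ fun i j => (L (b i j)).2)).trans ?_
      refine Eq.trans ?_ ih
      exact congrArg (fun z => Pi.lift z ≫ _) (funext fun i => ih' i)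
  have : Finite I := p.finite
  exact ⟨this, (OperadHom.op r ⟨p⟩).down, (congrArg (_ ≫ ·) (y.localHom_op hk h r ⟨p⟩)).symm.trans key⟩

/-- Label the two-vertex tree by `δ` at the root, `ε` at the inner edge and `μ`, `θ` at the leaves:
compatibility with both vertices gives compatibility with their composite. -/
theorem Evaluates.graft {M J : Type} {μ : M → y.Elt Z} {ε δ : y.Elt Z} {θ : J → y.Elt Z}
    (H : y.Evaluates hk (fun o : Option M => o.elim ε μ) δ) (H' : y.Evaluates hk θ ε) :
    y.Evaluates hk (Sum.elim μ θ) δ := by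
  obtain ⟨_, _⟩ := id H
  obtain ⟨_, _⟩ := id H'
  have : Finite M := Finite.of_injective some (Option.some_injective M)
  exact evaluates_of_vertices (R := RTree.graftTree M J) (RTree.atMostVertices_graftTree hk M J)
    (fun e : Option (Option (M ⊕ J)) => e.elim δ fun e => e.elim ε (Sum.elim μ θ))
    (fun v => match v with
      | false => H.of_equiv (RTree.graftTreeLower M J) fun o => by cases o <;> rfl
      | true => H'.of_equiv (RTree.graftTreeUpper M J) fun _ => rfl)
    (RTree.graftTree_isOp M J)

/-- Induction on the number of inputs still to be filled. The set `M` collects the inputs left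
alone; it has to vary, because it absorbs the inputs of each operation once that is grafted. -/
theorem Evaluates.comp_sum {I : Type} [Finite I] : ∀ {M : Type} {μ : M → y.Elt Z}
    {J : I → Type} {η : I → y.Elt Z} {θ : ∀ i, J i → y.Elt Z} {δ : y.Elt Z},
    y.Evaluates hk (Sum.elim μ η) δ → (∀ i, y.Evaluates hk (θ i) (η i)) →
      y.Evaluates hk (Sum.elim μ fun s : Σ i, J i => θ s.1 s.2) δ := by
  induction I using Finite.induction_empty_option with
  | of_equiv e ih =>
    intro M μ J η θ δ H H'
    have h1 := ih (J := fun i => J (e i)) (H.of_equiv ((Equiv.refl M).sumCongr e.symm)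
      (η' := Sum.elim μ fun i => η (e i)) (by rintro (m | i) <;> simp)) (fun i => H' (e i))
    exact h1.of_equiv ((Equiv.refl M).sumCongr (e.sigmaCongrLeft (β := J)))
      (by rintro (m | ⟨i, j⟩) <;> rfl)
  | h_empty =>
    intro M μ J η θ δ H H'
    exact H.of_equiv ((Equiv.refl M).sumCongr (Equiv.equivOfIsEmpty _ _))
      (by rintro (m | ⟨⟨⟩⟩); rfl)
  | @h_option I _ ih =>
    intro M μ J η θ δ H H'
    -- `e` singles out the input `none` for grafting, `e'` moves the new inputs `J none` to the
    -- finished ones, and `e''` reassembles the total family.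
    let e : M ⊕ Option I ≃ Option (M ⊕ I) :=
      { toFun := Sum.elim (fun m => some (.inl m)) (fun o => o.map .inr)
        invFun := fun o => o.elim (.inr none) (Sum.map id some)
        left_inv := by rintro (m | _ | i) <;> rfl
        right_inv := by rintro (_ | m | i) <;> rfl }
    let e' : (M ⊕ I) ⊕ J none ≃ (M ⊕ J none) ⊕ I :=
      { toFun := Sum.elim (Sum.map .inl id) fun j => .inl (.inr j)
        invFun := Sum.elim (Sum.map .inl id) fun i => .inl (.inr i)
        left_inv := by rintro ((m | i) | j) <;> rfl
        right_inv := by rintro ((m | i) | j) <;> rfl }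
    let e'' : (M ⊕ J none) ⊕ (Σ i, J (some i)) ≃ M ⊕ (Σ i, J i) :=
      { toFun := Sum.elim (Sum.map id fun j => ⟨none, j⟩) fun s => .inr ⟨some s.1, s.2⟩
        invFun := Sum.elim (fun m => .inl (.inl m)) fun s => match s with
          | ⟨none, j⟩ => .inl (.inr j)
          | ⟨some i, j⟩ => .inr ⟨i, j⟩
        left_inv := by rintro ((m | j) | s) <;> rfl
        right_inv := by rintro (m | ⟨_ | i, j⟩) <;> rfl }
    have h1 := H.of_equiv e (η' := fun o => o.elim (η none) (Sum.elim μ fun i => η (some i)))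
      (by rintro (m | _ | i) <;> rfl)
    have h2 := (h1.graft (H' none)).of_equiv e'
      (η' := Sum.elim (Sum.elim μ (θ none)) fun i => η (some i))
      (by rintro ((m | i) | j) <;> rfl)
    exact (ih h2 fun i => H' (some i)).of_equiv e'' (by rintro ((m | j) | s) <;> rfl)

theorem Evaluates.comp {I : Type} {J : I → Type} {η : I → y.Elt Z} {θ : ∀ i, J i → y.Elt Z}
    {δ : y.Elt Z} (H : y.Evaluates hk η δ) (H' : ∀ i, y.Evaluates hk (θ i) (η i)) :
    y.Evaluates hk (fun s : Σ i, J i => θ s.1 s.2) δ := by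
  obtain ⟨_, _⟩ := id H
  exact (comp_sum (μ := Empty.elim) (H.of_equiv (Equiv.emptySum Empty I).symm fun _ => rfl)
    H').of_equiv (Equiv.emptySum Empty _) (by rintro (⟨⟨⟩⟩ | s); rfl)

variable (y hk)

theorem opMap_comp {I : Type} [Finite I] {J : I → Type} [∀ i, Finite (J i)] {c : I → T.E}
    {d : T.E} {b : ∀ i, J i → T.E} (p : T.IsOp c d) (q : ∀ i, T.IsOp (b i) (c i)) :
    y.opMap hk (p.comp q) = graftMap (fun i => y.opMap hk (q i)) ≫ y.opMap hk p := by
  -- The universal generalized element: over this `Z` the inputs are the projections, whose lift is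
  -- the identity, so evaluation there is an equality of morphisms.
  let Z := ∏ᶜ fun s : Σ i, J i => y.colour (b s.1 s.2)
  let θ (i : I) (j : J i) : y.Elt Z :=
    ⟨b i j, Pi.π (fun s : Σ i, J i => y.colour (b s.1 s.2)) ⟨i, j⟩⟩
  let η (i : I) : y.Elt Z := ⟨c i, Pi.lift (fun j => (θ i j).2) ≫ y.opMap hk (q i)⟩
  have H : y.Evaluates hk η ⟨d, Pi.lift (fun i => (η i).2) ≫ y.opMap hk p⟩ := ⟨_, p, rfl⟩
  obtain ⟨_, p', hp'⟩ := H.comp (θ := θ) fun i => ⟨inferInstance, q i, rfl⟩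
  refine (Category.id_comp _).symm.trans ?_
  rw [← lift_proj]
  refine hp'.trans ?_
  refine Eq.trans ?_ (Category.id_comp _)
  rw [← lift_proj]
  refine Eq.trans ?_ (Category.assoc _ _ _)
  exact congrArg (· ≫ y.opMap hk p)
    (lift_graftMap (fun i => y.opMap hk (q i)) fun i j => (θ i j).2).symm

/-- The dendrex of the nerve that restricts to the members of the family. -/
noncomputable def glue : OperadHom T.operad (cartesianOperad S) where
  col := y.colour
  op p := y.opMap hk p.down
  map_one := y.opMap_one hk
  map_reindex e _ _ p := y.opMap_reindex hk e p.down
  map_comp p q := y.opMap_comp hk p.down fun i => (q i).down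

theorem isGlued_glue : y.IsGlued (y.glue hk) := fun h r =>
  (OperadHom.ext_of_heq (f := restr r (y.glue hk)) (g := y.localHom h r) rfl fun p =>
    heq_of_eq (y.localHom_op hk h r p).symm).trans (y.localHom_eq h r)

end MatchingFamily

/-- A dendrex of the nerve is determined by its restrictions to edges and corollas. -/
theorem nerve_separated {P : ColOperad.{u, v}} {k : ℕ} (hk : 2 ≤ k) {T : RTree}
    {t t' : OperadHom T.operad P}
    (H : ∀ {R : RTree}, AtMostVertices k R → ∀ r : R ⟶ T,
      OperadHom.comp r t = OperadHom.comp r t') : t = t' := by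
  refine OperadHom.ext_of_heq (funext fun e => ?_) fun {I _ c d} p => ?_
  · exact congrArg (fun f => OperadHom.col f ())
      (H (RTree.atMostVertices_eta k) (RTree.etaMap e))
  · exact OperadHom.op_heq (H (RTree.atMostVertices_corolla hk I) (RTree.corollaMap p.down))
      ⟨RTree.corolla_isOp I⟩

/-! ### The Grothendieck construction -/

/-- A dendrex of a coskeletal dendroidal set is determined by its restrictions to small trees. -/
theorem IsCoskeletal.separated {k : ℕ} {X : DSet.{w}} (hX : IsCoskeletal k X) {T : RTree}
    {z z' : X.obj (op T)}
    (H : ∀ {R : RTree}, AtMostVertices k R → ∀ r : R ⟶ T, X.map r.op z = X.map r.op z') :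
    z = z' := by
  let y : MatchingFamily k X T :=
    { val := fun _ r => X.map r.op z'
      map_val := fun _ _ α r => by
        rw [op_comp, Functor.map_comp]
        rfl }
  exact (hX.existsUnique y).unique (fun h r => H h r) fun _ _ => rfl

variable {S : Type u} [Category.{v} S] {X : Sᵒᵖ ⥤ DSet.{w}}

theorem map_comp_app {s s' s'' : S} (f : s ⟶ s') (g : s' ⟶ s'') {R : RTree}
    (z : (X.obj (op s'')).obj (op R)) :
    (X.map (f ≫ g).op).app (op R) z = (X.map f.op).app (op R) ((X.map g.op).app (op R) z) := by
  rw [op_comp, X.map_comp]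
  rfl

theorem map_app_map {s s' : S} (f : s ⟶ s') {A R : RTree} (a : A ⟶ R)
    (z : (X.obj (op s')).obj (op R)) :
    (X.obj (op s)).map a.op ((X.map f.op).app (op R) z) =
      (X.map f.op).app (op A) ((X.obj (op s')).map a.op z) :=
  (ConcreteCategory.congr_hom ((X.map f.op).naturality a.op) z).symm

theorem map_comp_apply {Y : DSet.{w}} {A B R : RTree} (a : A ⟶ B) (b : B ⟶ R)
    (z : Y.obj (op R)) : Y.map (a ≫ b).op z = Y.map a.op (Y.map b.op z) := by
  rw [op_comp, Functor.map_comp]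
  rfl

variable [HasFiniteProducts S]

namespace GrothDendrex

/-- The value of a dendrex at a map `r`, as an element over a dendrex `τ` of the nerve that is
equal to the given one. -/
def valueOver {T : RTree} (z : GrothDendrex X T) {τ : OperadHom T.operad (cartesianOperad S)}
    (h : z.t = τ) {R : RTree} (r : R ⟶ T) : (X.obj (op (inn (restr r τ)))).obj (op R) := by
  subst h
  exact z.x r

/-- Together with the next two lemmas this lets dendrices with propositionally equal nerve parts be
compared in one and the same fibre over `τ`. -/
theorem map_valueOver {T : RTree} (z : GrothDendrex X T)
    {τ : OperadHom T.operad (cartesianOperad S)} (h : z.t = τ) {R' R : RTree} (α : R' ⟶ R)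
    (r : R ⟶ T) :
    (X.obj (op (inn (restr r τ)))).map α.op (z.valueOver h r) =
      (X.map (innMap α (restr r τ)).op).app (op R') (z.valueOver h (α ≫ r)) := by
  subst h
  exact z.compat α r

theorem valueOver_restrict {B T : RTree} (b : B ⟶ T) (z : GrothDendrex X T)
    {z' : GrothDendrex X B} (hz : (groth X).map b.op z = z')
    {τ : OperadHom T.operad (cartesianOperad S)} (h : z.t = τ) (h' : z'.t = restr b τ)
    {R : RTree} (r : R ⟶ B) : z'.valueOver h' r = z.valueOver h (r ≫ b) := by
  subst h
  subst hz
  rfl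

theorem ext_of_valueOver {T : RTree} {z z' : GrothDendrex X T}
    {τ : OperadHom T.operad (cartesianOperad S)} (h : z.t = τ) (h' : z'.t = τ)
    (H : ∀ {R : RTree} (r : R ⟶ T), z.valueOver h r = z'.valueOver h' r) : z = z' := by
  obtain ⟨t, x, _⟩ := z
  obtain ⟨t', x', _⟩ := z'
  obtain rfl : t = τ := h
  obtain rfl : t' = t := h'
  obtain rfl : @x = @x' := by
    funext R r
    exact H r
  rfl

end GrothDendrex

section Glue

variable {k : ℕ} {T : RTree} (y : MatchingFamily k (groth X) T)
  {t : OperadHom T.operad (cartesianOperad S)}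
  (ht : ∀ {R : RTree} (h : AtMostVertices k R) (r : R ⟶ T), (y.val h r).t = restr r t)

/-- The matching family of the underlying dendrices of the nerve. -/
noncomputable def MatchingFamily.base : MatchingFamily k (nerve (cartesianOperad S)) T where
  val h r := (y.val h r).t
  map_val h' h α r := congrArg GrothDendrex.t (y.map_val h' h α r)

/-- The top component of a member of the family. -/
noncomputable def MatchingFamily.top {R : RTree} (h : AtMostVertices k R) (r : R ⟶ T) :
    (X.obj (op (inn (restr r t)))).obj (op R) :=
  GrothDendrex.valueOver (y.val h r) (ht h r) (𝟙 R)

/-- Compatibility inside one member, then matching between members: all values of a member, even at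
trees `B` that are not small, are controlled by the top components at small trees. -/
theorem MatchingFamily.map_valueOver {R : RTree} (h : AtMostVertices k R) (r : R ⟶ T)
    {A B : RTree} (hA : AtMostVertices k A) (a : A ⟶ B) (s : B ⟶ R) :
    (X.obj (op (inn (restr s (restr r t))))).map a.op
        (GrothDendrex.valueOver (y.val h r) (ht h r) s) =
      (X.map (innMap a (restr s (restr r t))).op).app (op A) (y.top ht hA ((a ≫ s) ≫ r)) := by
  refine (GrothDendrex.map_valueOver _ (ht h r) a s).trans ?_
  refine congrArg ((X.map (innMap a (restr s (restr r t))).op).app (op A)) ?_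
  exact (GrothDendrex.valueOver_restrict (a ≫ s) (y.val h r) (y.map_val hA h (a ≫ s) r)
    (ht h r) (ht hA ((a ≫ s) ≫ r)) (𝟙 A)).symm

theorem MatchingFamily.map_top {R : RTree} (h : AtMostVertices k R) (r : R ⟶ T)
    {A : RTree} (hA : AtMostVertices k A) (a : A ⟶ R) :
    (X.obj (op (inn (restr r t)))).map a.op (y.top ht h r) =
      (X.map (innMap a (restr r t)).op).app (op A) (y.top ht hA (a ≫ r)) :=
  y.map_valueOver ht h r hA a (𝟙 R)

/-- The matching family over `R` for the value of the glued dendrex at `r : R ⟶ T`. -/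
noncomputable def MatchingFamily.fibre {R : RTree} (r : R ⟶ T) :
    MatchingFamily k (X.obj (op (inn (restr r t)))) R where
  val {A} h a := (X.map (innMap a (restr r t)).op).app (op A) (y.top ht h (a ≫ r))
  map_val {A' A} h' h b a := by
    refine (map_app_map (innMap a (restr r t)) b _).trans ?_
    refine (congrArg ((X.map (innMap a (restr r t)).op).app (op A'))
      (y.map_top ht h (a ≫ r) h' b)).trans ?_
    refine (map_comp_app _ _ _).symm.trans ?_
    exact congrArg (fun f : inn (restr r t) ⟶ inn (restr (b ≫ a) (restr r t)) =>
      (X.map f.op).app (op A') (y.top ht h' ((b ≫ a) ≫ r))) (innMap_comp b a (restr r t)).symm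

variable (hX : ∀ s : S, IsCoskeletal k (X.obj (op s)))

/-- The dendrex of the Grothendieck construction over `t` that restricts to the members of the
family. -/
noncomputable def MatchingFamily.glueOver : GrothDendrex X T where
  t := t
  x r := ((hX _).existsUnique (y.fibre ht r)).choose
  compat {R' R} α r := by
    -- Restricted to a small `A`, both sides come from the top component at `(a ≫ α) ≫ r`, moved
    -- along `in(a ≫ α)` and along its factorization.
    refine (hX _).separated fun {A} hA a => ?_
    refine (map_comp_apply a α _).symm.trans ?_
    refine (((hX _).existsUnique (y.fibre ht r)).choose_spec.1 hA (a ≫ α)).trans ?_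
    refine Eq.trans ?_ (map_app_map (innMap α (restr r t)) a _).symm
    refine Eq.trans ?_ (congrArg ((X.map (innMap α (restr r t)).op).app (op A))
      (((hX _).existsUnique (y.fibre ht (α ≫ r))).choose_spec.1 hA a)).symm
    refine Eq.trans ?_ (map_comp_app _ _ _)
    exact congrArg (fun f : inn (restr r t) ⟶ inn (restr (a ≫ α) (restr r t)) =>
      (X.map f.op).app (op A) (y.top ht hA ((a ≫ α) ≫ r))) (innMap_comp a α (restr r t))

theorem MatchingFamily.isGlued_glueOver : y.IsGlued (y.glueOver ht hX) := by
  intro R h r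
  refine GrothDendrex.ext_of_valueOver (τ := restr r t) rfl (ht h r) fun {B} s => ?_
  refine (hX _).separated fun {A} hA a => ?_
  exact (((hX _).existsUnique (y.fibre ht (s ≫ r))).choose_spec.1 hA a).trans
    (y.map_valueOver ht h r hA a s).symm

end Glue

/-- The nerve parts agree by `nerve_separated`. The value at `r` is detected by small `a : A ⟶ R`,
where it depends only on the value at `a ≫ r`. -/
theorem groth_separated {k : ℕ} (hk : 2 ≤ k) (hX : ∀ s : S, IsCoskeletal k (X.obj (op s)))
    {T : RTree} {z z' : GrothDendrex X T}
    (H : ∀ {R : RTree}, AtMostVertices k R → ∀ r : R ⟶ T,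
      (groth X).map r.op z = (groth X).map r.op z') : z = z' := by
  have ht : z'.t = z.t := nerve_separated hk fun h r => congrArg GrothDendrex.t (H h r).symm
  refine GrothDendrex.ext_of_valueOver rfl ht fun {R} r => ?_
  refine (hX _).separated fun {A} hA a => ?_
  refine (z.map_valueOver rfl a r).trans (Eq.trans ?_ (z'.map_valueOver ht a r).symm)
  refine congrArg ((X.map (innMap a (restr r z.t)).op).app (op A)) ?_
  -- The value at `a ≫ r` is the identity component of the restriction to the small tree `A`, which
  -- the two dendrices share.
  exact GrothDendrex.valueOver_restrict (a ≫ r) z' (H hA (a ≫ r)).symm ht rfl (𝟙 A)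

end Dendroidal

theorem mainTheorem3 {S : Type u} [Category.{v} S] [HasFiniteProducts S]
    (X : Sᵒᵖ ⥤ Dendroidal.DSet.{w}) (k : ℕ) (hk : 2 ≤ k)
    (hX : ∀ s : S, Dendroidal.IsCoskeletal k (X.obj (op s))) :
    Dendroidal.IsCoskeletal k (Dendroidal.groth X) := by
  refine Dendroidal.isCoskeletal_of_existsUnique fun T y => ?_
  have ht {R : Dendroidal.RTree} (h : Dendroidal.AtMostVertices k R) (r : R ⟶ T) :
      (y.val h r).t = Dendroidal.restr r (y.base.glue hk) := (y.base.isGlued_glue hk h r).symm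
  refine ⟨y.glueOver ht hX, y.isGlued_glueOver ht hX, fun z hz => ?_⟩
  exact Dendroidal.groth_separated hk hX fun h r =>
    (hz h r).trans (y.isGlued_glueOver ht hX h r).symm
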